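/- Let $(\Omega,\mathcal F,P)$ be a probability space, $d$ a positive integer, and let $\xi(t)=(\xi_1(t),\dots,\xi_d(t))$, $t\ge 0$, be a stationary $\mathbb R^d$-valued stochastic process on it (that is, its finite-dimensional distributions are invariant under time shifts $t\mapsto t+h$, $h\ge 0$) whose paths $t\mapsto\xi(t)$ are almost surely continuous on $[0,\infty)$ and which satisfies $E|\xi(0)|<\infty$. Then there is a random vector $Q=(Q_1,\dots,Q_d)$ with $$\lim_{t\to\infty}\frac1t\int_0^t\xi(s)\,ds=Q\qquad\text{almost surely.}$$ For any such $Q$, with probability one, for all $\nu\ge 1$ and all $1\le i_1,\dots,i_\nu\le d$, $$\lim_{t\to\infty}t^{-\nu}\,\Sigma^{i_1,\dots,i_\nu}(t)=\frac1{\nu!}\prod_{j=1}^{\nu}Q_{i_j},$$ where $$\Sigma^{i_1,\dots,i_\nu}(t)=\int_{0\le s_1\le\dots\le s_\nu\le t}\xi_{i_1}(s_1)\cdots\xi_{i_\nu}(s_\nu)\,ds_1\cdots ds_\nu .$$ -/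

import Mathlib

open MeasureTheory Filter Topology
open scoped NNReal Nat

/-- A process `ξ` indexed by times `t ≥ 0` is (strictly) stationary under `P` if its
finite-dimensional distributions do not change under a time shift by any `h ≥ 0`. -/
def IsStationaryProcess {Ω E : Type*} [MeasurableSpace Ω] [MeasurableSpace E]
    (ξ : ℝ≥0 → Ω → E) (P : Measure Ω) : Prop :=
  ∀ (h : ℝ≥0) (n : ℕ) (t : Fin n → ℝ≥0),
    P.map (fun ω (j : Fin n) => ξ (t j + h) ω) = P.map (fun ω (j : Fin n) => ξ (t j) ω)

/-- The ordered simplex `{(s_1, …, s_ν) : 0 ≤ s_1 ≤ … ≤ s_ν ≤ t}`. -/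
def orderedSimplex (ν : ℕ) (t : ℝ) : Set (Fin ν → ℝ) :=
  {s | (∀ j, 0 ≤ s j ∧ s j ≤ t) ∧ ∀ j k, j ≤ k → s j ≤ s k}

/-- The iterated integral
`∫_{0 ≤ s_1 ≤ … ≤ s_ν ≤ t} x_{i_1}(s_1) ⋯ x_{i_ν}(s_ν) ds_1 ⋯ ds_ν` of a path `x` in `ℝ^d`
(the integration variables are nonnegative, so `Real.toNNReal` only changes their type). -/
noncomputable def iteratedPathIntegral {d ν : ℕ} (x : ℝ≥0 → EuclideanSpace ℝ (Fin d))
    (i : Fin ν → Fin d) (t : ℝ) : ℝ :=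
  ∫ s in orderedSimplex ν t, ∏ j, x (s j).toNNReal (i j)

/-- The time average `t⁻¹ ∫_0^t x(s) ds` of a path `x` in `ℝ^d`. -/
noncomputable def timeAverage {d : ℕ} (x : ℝ≥0 → EuclideanSpace ℝ (Fin d)) (t : ℝ) :
    EuclideanSpace ℝ (Fin d) :=
  t⁻¹ • ∫ s in (0 : ℝ)..t, x s.toNNReal

/-! The proof has a deterministic half and a probabilistic half.

Deterministic: fix a continuous path whose coordinates have time means `q k` and absolute integrals
of order `t`. Induct on `ν`: if the inner iterated integral is `c s^ν + o(s^ν)`, integrating it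
against a coordinate `x` leaves `c ∫ x s^ν`, which integration by parts evaluates from the mean of
`x`, plus an error controlled by `∫ |x|`. Each step divides by `ν + 1`, whence `1/ν!`
(`tendsto_iteratedPrimitive`).

Probabilistic: the means of each coordinate and of its absolute value converge almost surely. This
is Birkhoff's theorem for the unit shift on path space, applied to `w ↦ ∫_0^1 g(w(s)) ds`, followed
by passage from integer to real times (`tendsto_average_of_natCast`). Birkhoff's theorem follows
from the maximal inequality: on an invariant set where the Birkhoff sums of `g` are unbounded above,
`∫ g ≥ 0`. Taking `g = f - b` and `g = a - f` with `a < b` excludes oscillation of the averages. -/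

section Birkhoff

/-! ### Birkhoff's pointwise ergodic theorem. -/

variable {α : Type*} {T : α → α} {g : α → ℝ}

/-- The running maximum `max_{0 ≤ k ≤ n} S_k g` of the Birkhoff sums of `g`. -/
def birkhoffMax (T : α → α) (g : α → ℝ) : ℕ → α → ℝ
  | 0, _ => 0
  | n + 1, x => max 0 (g x + birkhoffMax T g n (T x))

lemma birkhoffMax_nonneg (n : ℕ) (x : α) : 0 ≤ birkhoffMax T g n x := by
  cases n <;> simp [birkhoffMax]

lemma birkhoffMax_le_succ (n : ℕ) (x : α) : birkhoffMax T g n x ≤ birkhoffMax T g (n + 1) x := by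
  induction n generalizing x with
  | zero => exact birkhoffMax_nonneg 1 x
  | succ n ih => exact max_le_max le_rfl (by gcongr; exact ih (T x))

lemma birkhoffMax_mono (x : α) : Monotone fun n => birkhoffMax T g n x :=
  monotone_nat_of_le_succ fun n => birkhoffMax_le_succ n x

lemma birkhoffSum_le_birkhoffMax (n : ℕ) (x : α) : birkhoffSum T g n x ≤ birkhoffMax T g n x := by
  induction n generalizing x with
  | zero => simp [birkhoffMax]
  | succ n ih =>
    rw [birkhoffSum_succ']
    exact le_max_of_le_right (by gcongr; exact ih (T x))

lemma tendsto_birkhoffMax_atTop {x : α}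
    (hx : ¬ BddAbove (Set.range fun n => birkhoffSum T g n x)) :
    Tendsto (fun n => birkhoffMax T g n x) atTop atTop := by
  refine tendsto_atTop_atTop_of_monotone (birkhoffMax_mono x) fun b => ?_
  rw [not_bddAbove_iff] at hx
  obtain ⟨_, ⟨n, rfl⟩, hn⟩ := hx b
  exact ⟨n, hn.le.trans (birkhoffSum_le_birkhoffMax n x)⟩

/-- Since `S_{n+1} g(x) = g(x) + S_n g(Tx)`, the unboundedness set is exactly `T`-invariant, so `T`
preserves the measure restricted to it. -/
lemma not_bddAbove_birkhoffSum_comp_iff {x : α} :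
    (¬ BddAbove (Set.range fun n => birkhoffSum T g n (T x))) ↔
      ¬ BddAbove (Set.range fun n => birkhoffSum T g n x) := by
  refine not_congr ⟨fun ⟨C, hC⟩ => ⟨max 0 (g x + C), ?_⟩, fun ⟨C, hC⟩ => ⟨C - g x, ?_⟩⟩
  · rintro _ ⟨n, rfl⟩
    cases n with
    | zero => simp
    | succ n =>
      have := hC ⟨n, rfl⟩
      simp only [birkhoffSum_succ'] at this ⊢
      exact le_max_of_le_right (by linarith)
  · rintro _ ⟨n, rfl⟩
    have := hC ⟨n + 1, rfl⟩
    simp only [birkhoffSum_succ'] at this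
    simp only
    linarith

lemma birkhoffSum_sub_const (f : α → ℝ) (b : ℝ) (n : ℕ) (x : α) :
    birkhoffSum T (fun x => f x - b) n x = birkhoffSum T f n x - n * b := by
  simp [birkhoffSum]

lemma birkhoffSum_const_sub (f : α → ℝ) (b : ℝ) (n : ℕ) (x : α) :
    birkhoffSum T (fun x => b - f x) n x = n * b - birkhoffSum T f n x := by
  simp [birkhoffSum]

variable [MeasurableSpace α] {μ : Measure α}

lemma measurable_birkhoffSum (hT : Measurable T) (hg : Measurable g) (n : ℕ) :
    Measurable (birkhoffSum T g n) :=
  Finset.measurable_fun_sum _ fun k _ => hg.comp (hT.iterate k)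

lemma integrable_birkhoffMax (hT : MeasurePreserving T μ μ) (hg : Integrable g μ) (n : ℕ) :
    Integrable (birkhoffMax T g n) μ := by
  induction n with
  | zero => exact integrable_zero _ _ _
  | succ n ih => exact (integrable_zero _ _ _).sup (hg.add (hT.integrable_comp_of_integrable ih))

/-- The maximal ergodic inequality on the invariant set where the Birkhoff sums are unbounded. -/
lemma integral_nonneg_of_not_bddAbove_birkhoffSum (hT : MeasurePreserving T μ μ)
    (hg : Integrable g μ)
    (hub : ∀ᵐ x ∂μ, ¬ BddAbove (Set.range fun n => birkhoffSum T g n x)) :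
    0 ≤ ∫ x, g x ∂μ := by
  have hM := integrable_birkhoffMax hT hg
  have hMT n : Integrable (fun x => birkhoffMax T g n (T x)) μ :=
    hT.integrable_comp_of_integrable (hM n)
  -- The integrand is `M_{n+1} - M_n ∘ T`; `M_n ∘ T` has the same integral as `M_n ≤ M_{n+1}`.
  have key n : 0 ≤ ∫ x, max (-birkhoffMax T g n (T x)) (g x) ∂μ := by
    have h1 : ∫ x, birkhoffMax T g n (T x) ∂μ = ∫ x, birkhoffMax T g n x ∂μ := by
      conv_rhs => rw [← hT.map_eq]
      exact (integral_map hT.aemeasurable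
        (by rw [hT.map_eq]; exact (hM n).aestronglyMeasurable)).symm
    have h2 : ∀ x, max (-birkhoffMax T g n (T x)) (g x)
        = birkhoffMax T g (n + 1) x - birkhoffMax T g n (T x) := by
      intro x
      simp only [birkhoffMax]
      rw [← max_sub_sub_right]
      simp
    simp_rw [h2]
    rw [integral_sub (hM _) (hMT n), h1, sub_nonneg]
    exact integral_mono (hM n) (hM (n + 1)) (birkhoffMax_le_succ n)
  -- As `M_n(Tx) → ∞`, the maximum is eventually `g x`.
  have hlim : Tendsto (fun n => ∫ x, max (-birkhoffMax T g n (T x)) (g x) ∂μ) atTop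
      (𝓝 (∫ x, g x ∂μ)) := by
    refine tendsto_integral_of_dominated_convergence (fun x => ‖g x‖)
      (fun n => ((hMT n).neg.sup hg).aestronglyMeasurable) hg.norm (fun n => ?_) ?_
    · refine ae_of_all _ fun x => ?_
      have := birkhoffMax_nonneg (T := T) (g := g) n (T x)
      simp only [Real.norm_eq_abs]
      rcases max_cases (-birkhoffMax T g n (T x)) (g x) with h | h
      · rw [h.1]
        exact abs_le_abs_of_nonpos (by linarith) h.2
      · rw [h.1]
    · filter_upwards [hub] with x hx
      refine tendsto_const_nhds.congr' ?_
      filter_upwards [(tendsto_birkhoffMax_atTop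
        (not_bddAbove_birkhoffSum_comp_iff.2 hx)).eventually_ge_atTop (-g x)] with n hn
      exact (max_eq_right (by linarith)).symm
  exact ge_of_tendsto' hlim key

lemma measurableSet_not_bddAbove_birkhoffSum (hT : Measurable T) (hg : Measurable g) :
    MeasurableSet {x | ¬ BddAbove (Set.range fun n => birkhoffSum T g n x)} := by
  exact (measurableSet_bddAbove_range fun n => measurable_birkhoffSum hT hg n).compl

lemma setIntegral_nonneg_of_not_bddAbove_birkhoffSum (hT : MeasurePreserving T μ μ)
    (hg : Integrable g μ) {s : Set α} (hs : MeasurableSet s) (hTs : T ⁻¹' s = s)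
    (hub : ∀ x ∈ s, ¬ BddAbove (Set.range fun n => birkhoffSum T g n x)) :
    0 ≤ ∫ x in s, g x ∂μ := by
  have h := hT.restrict_preimage hs
  rw [hTs] at h
  exact integral_nonneg_of_not_bddAbove_birkhoffSum h hg.integrableOn
    ((ae_restrict_iff' hs).2 (ae_of_all _ hub))

variable [IsFiniteMeasure μ]

/-- On the exceptional set `s` the maximal inequality gives `b μ(s) ≤ ∫_s f` for every `b`, forcing
`μ(s) = 0`. This keeps the averages of `f` bounded above. -/
lemma ae_exists_bddAbove_birkhoffSum_sub (hT : MeasurePreserving T μ μ) {f : α → ℝ}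
    (hfm : Measurable f) (hf : Integrable f μ) :
    ∀ᵐ x ∂μ, ∃ b : ℕ, BddAbove (Set.range fun n => birkhoffSum T (fun x => f x - b) n x) := by
  set s : Set α := ⋂ b : ℕ, {x | ¬ BddAbove (Set.range fun n =>
    birkhoffSum T (fun x => f x - b) n x)} with hs_def
  have hs : MeasurableSet s := MeasurableSet.iInter fun b =>
    measurableSet_not_bddAbove_birkhoffSum hT.measurable (hfm.sub_const _)
  have hTs : T ⁻¹' s = s := by
    ext x
    simp only [hs_def, Set.mem_preimage, Set.mem_iInter, Set.mem_ofPred_eq,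
      not_bddAbove_birkhoffSum_comp_iff]
  have key (b : ℕ) : b * μ.real s ≤ ∫ x in s, f x ∂μ := by
    have := setIntegral_nonneg_of_not_bddAbove_birkhoffSum hT
      (hf.sub (integrable_const (b : ℝ))) hs hTs fun x hx => Set.mem_iInter.1 hx b
    simp only [Pi.sub_apply] at this
    rw [integral_sub hf.integrableOn (integrable_const _)] at this
    simp at this
    linarith
  have h0 : μ.real s = 0 := by
    by_contra h
    have hpos : 0 < μ.real s := lt_of_le_of_ne measureReal_nonneg (Ne.symm h)
    obtain ⟨b, hb⟩ := exists_nat_gt ((∫ x in s, f x ∂μ) / μ.real s)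
    rw [div_lt_iff₀ hpos] at hb
    linarith [key b]
  rw [measureReal_eq_zero_iff] at h0
  filter_upwards [measure_eq_zero_iff_ae_notMem.1 h0] with x hx
  simpa [hs_def] using hx

/-- Where both fail, `b μ(s) ≤ ∫_s f ≤ a μ(s)` with `a < b`, so `μ(s) = 0`. -/
lemma ae_bddAbove_birkhoffSum_sub_or (hT : MeasurePreserving T μ μ) {f : α → ℝ}
    (hfm : Measurable f) (hf : Integrable f μ) {a b : ℝ} (hab : a < b) :
    ∀ᵐ x ∂μ, BddAbove (Set.range fun n => birkhoffSum T (fun x => f x - b) n x) ∨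
      BddAbove (Set.range fun n => birkhoffSum T (fun x => a - f x) n x) := by
  set s : Set α := {x | ¬ BddAbove (Set.range fun n => birkhoffSum T (fun x => f x - b) n x)} ∩
    {x | ¬ BddAbove (Set.range fun n => birkhoffSum T (fun x => a - f x) n x)} with hs_def
  have hs : MeasurableSet s :=
    (measurableSet_not_bddAbove_birkhoffSum hT.measurable (hfm.sub_const _)).inter
      (measurableSet_not_bddAbove_birkhoffSum hT.measurable (hfm.const_sub _))
  have hTs : T ⁻¹' s = s := by
    ext x
    simp only [hs_def, Set.mem_preimage, Set.mem_inter_iff, Set.mem_ofPred_eq,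
      not_bddAbove_birkhoffSum_comp_iff]
  have h1 := setIntegral_nonneg_of_not_bddAbove_birkhoffSum hT
      (hf.sub (integrable_const b)) hs hTs fun x hx => hx.1
  have h2 := setIntegral_nonneg_of_not_bddAbove_birkhoffSum hT
      ((integrable_const a).sub hf) hs hTs fun x hx => hx.2
  simp only [Pi.sub_apply] at h1 h2
  rw [integral_sub hf.integrableOn (integrable_const _)] at h1
  rw [integral_sub (integrable_const _) hf.integrableOn] at h2
  simp at h1 h2
  have h0 : μ.real s = 0 := by
    have : 0 ≤ μ.real s := measureReal_nonneg
    nlinarith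
  rw [measureReal_eq_zero_iff] at h0
  filter_upwards [measure_eq_zero_iff_ae_notMem.1 h0] with x hx
  by_contra hcon
  rw [not_or] at hcon
  exact hx hcon

lemma not_frequently_lt_div_of_bddAbove {u : ℕ → ℝ} {b c : ℝ} (hbc : b < c)
    (h : BddAbove (Set.range fun n => u n - n * b)) : ¬ ∃ᶠ n : ℕ in atTop, c < (n : ℝ)⁻¹ * u n := by
  obtain ⟨C, hC⟩ := h
  rw [not_frequently]
  have hlim : Tendsto (fun n : ℕ => (n : ℝ) * (c - b)) atTop atTop :=
    tendsto_natCast_atTop_atTop.atTop_mul_const (sub_pos.2 hbc)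
  filter_upwards [hlim.eventually_ge_atTop C, eventually_gt_atTop 0] with n hn hpos
  have h1 := hC ⟨n, rfl⟩
  have h2 : (0 : ℝ) < n := by exact_mod_cast hpos
  simp only at h1
  rw [not_lt, inv_mul_le_iff₀ h2]
  linarith

/-- **Birkhoff's pointwise ergodic theorem**, existence of the limit. -/
theorem ae_exists_tendsto_birkhoffAverage (hT : MeasurePreserving T μ μ) {f : α → ℝ}
    (hfm : Measurable f) (hf : Integrable f μ) :
    ∀ᵐ x ∂μ, ∃ l : ℝ, Tendsto (fun n => birkhoffAverage ℝ T f n x) atTop (𝓝 l) := by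
  have h1 := ae_exists_bddAbove_birkhoffSum_sub hT hfm hf
  have h2 := ae_exists_bddAbove_birkhoffSum_sub hT hfm.neg hf.neg
  have h3 : ∀ᵐ x ∂μ, ∀ a b : ℚ, a < b →
      BddAbove (Set.range fun n => birkhoffSum T (fun x => f x - b) n x) ∨
      BddAbove (Set.range fun n => birkhoffSum T (fun x => a - f x) n x) := by
    simp_rw [ae_all_iff]
    exact fun a b hab => ae_bddAbove_birkhoffSum_sub_or hT hfm hf (by exact_mod_cast hab)
  filter_upwards [h1, h2, h3] with x ⟨B, hB⟩ ⟨A, hA⟩ hx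
  simp only [birkhoffAverage, smul_eq_mul]
  simp only [birkhoffSum_sub_const, birkhoffSum_const_sub] at hB hx
  have hneg {a c : ℝ} (hac : c < a)
      (h : BddAbove (Set.range fun n : ℕ => n * a - birkhoffSum T f n x)) :
      ¬ ∃ᶠ n : ℕ in atTop, (n : ℝ)⁻¹ * birkhoffSum T f n x < c := by
    have := not_frequently_lt_div_of_bddAbove (u := fun n => - birkhoffSum T f n x)
      (neg_lt_neg hac) (by convert h using 3; ring_nf)
    simpa only [mul_neg, neg_lt_neg_iff] using this
  have hA' : BddAbove (Set.range fun n : ℕ => n * (-A : ℝ) - birkhoffSum T f n x) := by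
    convert hA using 3 with n
    simp [birkhoffSum]
    ring
  refine tendsto_of_no_upcrossings Rat.isDenseEmbedding_coe_real.dense ?_ ?_ ?_
  · rintro _ ⟨a, rfl⟩ _ ⟨b, rfl⟩ hab ⟨ha, hb⟩
    have hab' : a < b := by exact_mod_cast hab
    -- Choose `a < a' < b' < b`: bounded sums only bound the averages up to `O(1/n)`, so strict room
    -- is needed.
    obtain ⟨a', h1, h2⟩ := exists_between hab'
    obtain ⟨b', h3, h4⟩ := exists_between h2
    rcases hx a' b' h3 with h | h
    · exact not_frequently_lt_div_of_bddAbove (by exact_mod_cast h4) h hb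
    · exact hneg (by exact_mod_cast h1) h ha
  · have := not_frequently_lt_div_of_bddAbove (lt_add_one (B : ℝ)) hB
    rw [not_frequently] at this
    exact ⟨_, eventually_map.2 (this.mono fun n hn => not_lt.1 hn)⟩
  · have := hneg (sub_one_lt (-A : ℝ)) hA'
    rw [not_frequently] at this
    exact ⟨_, eventually_map.2 (this.mono fun n hn => not_lt.1 hn)⟩

/-- Birkhoff's pointwise ergodic theorem with a measurable limit. -/
theorem exists_measurable_tendsto_birkhoffAverage (hT : MeasurePreserving T μ μ) {f : α → ℝ}
    (hfm : Measurable f) (hf : Integrable f μ) :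
    ∃ l : α → ℝ, Measurable l ∧
      ∀ᵐ x ∂μ, Tendsto (fun n => birkhoffAverage ℝ T f n x) atTop (𝓝 (l x)) :=
  measurable_limit_of_tendsto_metrizable_ae
    (fun n => ((measurable_birkhoffSum hT.measurable hfm n).const_smul (n : ℝ)⁻¹).aemeasurable)
    (ae_exists_tendsto_birkhoffAverage hT hfm hf)

end Birkhoff

section Asymptotics

/-! ### Deterministic asymptotics of iterated primitives. -/

open Asymptotics

lemma isLittleO_integral_mul {w e : ℝ → ℝ} {n : ℕ} (hw : Continuous w) (he : Continuous e)
    (hW : (fun t => ∫ s in (0 : ℝ)..t, |w s|) =O[atTop] fun t : ℝ => t)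
    (heo : e =o[atTop] fun s : ℝ => s ^ n) :
    (fun t => ∫ s in (0 : ℝ)..t, w s * e s) =o[atTop] fun t : ℝ => t ^ (n + 1) := by
  rw [isLittleO_iff]
  intro c hc
  obtain ⟨K, hK, hWK⟩ := hW.exists_pos
  -- With this bound on `e` past `s₀`, the tail is at most `K t · (c/2K) t^n`, half the allowance;
  -- the fixed integral up to `s₀` takes the other half.
  have hε : 0 < c / (2 * K) := by positivity
  obtain ⟨s₀, hs₀⟩ := eventually_atTop.1
    ((eventually_ge_atTop (0 : ℝ)).and ((isLittleO_iff.1 heo) hε))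
  have hs₀0 : 0 ≤ s₀ := (hs₀ s₀ le_rfl).1
  have hpow : Tendsto (fun t : ℝ => c / 2 * t ^ (n + 1)) atTop atTop :=
    (tendsto_pow_atTop (Nat.succ_ne_zero n)).const_mul_atTop (by positivity)
  filter_upwards [hWK.bound, eventually_ge_atTop s₀,
    hpow.eventually_ge_atTop |∫ s in (0 : ℝ)..s₀, w s * e s|] with t hWt hst hC
  have ht : 0 ≤ t := hs₀0.trans hst
  have hint : Continuous fun s => w s * e s := hw.mul he
  rw [← intervalIntegral.integral_add_adjacent_intervals
    (hint.intervalIntegrable 0 s₀) (hint.intervalIntegrable s₀ t)]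
  have h2 : |∫ s in s₀..t, w s * e s| ≤ c / 2 * t ^ (n + 1) := by
    have hb : |∫ s in s₀..t, w s * e s| ≤ ∫ s in s₀..t, |w s| * (c / (2 * K) * t ^ n) := by
      rw [← Real.norm_eq_abs]
      refine intervalIntegral.norm_integral_le_of_norm_le hst (ae_of_all _ fun s hs => ?_)
        ((hw.abs.mul continuous_const).intervalIntegrable _ _)
      have hs' := (hs₀ s hs.1.le)
      rw [norm_mul, Real.norm_eq_abs]
      gcongr
      refine hs'.2.trans ?_
      rw [Real.norm_eq_abs, abs_of_nonneg (pow_nonneg hs'.1 n)]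
      have := hs.2
      have := hs'.1
      gcongr
    have hsub : ∫ s in s₀..t, |w s| ≤ K * t := by
      have h1 : ∫ s in s₀..t, |w s| ≤ ∫ s in (0 : ℝ)..t, |w s| :=
        intervalIntegral.integral_mono_interval hs₀0 hst le_rfl
          (ae_of_all _ fun s => abs_nonneg _) (hw.abs.intervalIntegrable _ _)
      simp only [Real.norm_eq_abs, abs_of_nonneg ht] at hWt
      exact h1.trans ((le_abs_self _).trans hWt)
    rw [intervalIntegral.integral_mul_const] at hb
    calc _ ≤ _ := hb
      _ ≤ K * t * (c / (2 * K) * t ^ n) := by gcongr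
      _ = c / 2 * t ^ (n + 1) := by rw [pow_succ]; field_simp
  rw [Real.norm_eq_abs, Real.norm_eq_abs, abs_of_nonneg (pow_nonneg ht _)]
  refine (abs_add_le _ _).trans ?_
  linarith

lemma isLittleO_integral_of_isLittleO {e : ℝ → ℝ} {n : ℕ} (he : Continuous e)
    (heo : e =o[atTop] fun s : ℝ => s ^ n) :
    (fun t => ∫ s in (0 : ℝ)..t, e s) =o[atTop] fun t : ℝ => t ^ (n + 1) := by
  have := isLittleO_integral_mul (w := fun _ => 1) continuous_const he
    (by simpa using isBigO_refl _ _) heo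
  simpa using this

/-- Integration by parts moves everything onto the primitive `F = o(t)`, so cancellation in `X`
suffices. -/
lemma isLittleO_integral_mul_pow {X : ℝ → ℝ} (hX : Continuous X)
    (hXo : (fun t => ∫ s in (0 : ℝ)..t, X s) =o[atTop] fun t : ℝ => t) (n : ℕ) :
    (fun t => ∫ s in (0 : ℝ)..t, X s * s ^ n) =o[atTop] fun t : ℝ => t ^ (n + 1) := by
  set F : ℝ → ℝ := fun t => ∫ s in (0 : ℝ)..t, X s with hF
  have hFd t : HasDerivAt F (X t) t := hX.integral_hasStrictDerivAt 0 t |>.hasDerivAt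
  have hFc : Continuous F := continuous_iff_continuousAt.2 fun t => (hFd t).continuousAt
  have hparts t : ∫ s in (0 : ℝ)..t, X s * s ^ n
      = t ^ n * F t - ∫ s in (0 : ℝ)..t, (n * s ^ (n - 1)) * F s := by
    have := intervalIntegral.integral_mul_deriv_eq_deriv_mul (a := 0) (b := t)
      (u := fun s : ℝ => s ^ n) (v := F) (u' := fun s => n * s ^ (n - 1)) (v' := X)
      (fun s _ => hasDerivAt_pow n s) (fun s _ => hFd s)
      (Continuous.intervalIntegrable (by fun_prop) _ _) (hX.intervalIntegrable _ _)
    simp_rw [mul_comm (X _)]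
    rw [this]
    simp [hF]
  simp_rw [hparts]
  refine IsLittleO.sub ?_ (isLittleO_integral_of_isLittleO (by fun_prop) ?_)
  · simp_rw [pow_succ]
    exact (isBigO_refl _ _).mul_isLittleO hXo
  · cases n with
    | zero => simp
    | succ m =>
      simp_rw [pow_succ, Nat.add_sub_cancel]
      exact (isBigO_const_mul_self _ _ _).mul_isLittleO hXo

/-- If `x` has mean `q` and bounded absolute means and `y(s) ∼ c sⁿ`, then
`∫_0^t x y ∼ q c t^(n+1) / (n+1)`. -/
lemma isLittleO_integral_mul_sub {x y : ℝ → ℝ} {q c : ℝ} {n : ℕ} (hx : Continuous x)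
    (hy : Continuous y)
    (hxq : (fun t => (∫ s in (0 : ℝ)..t, x s) - q * t) =o[atTop] fun t : ℝ => t)
    (hxabs : (fun t => ∫ s in (0 : ℝ)..t, |x s|) =O[atTop] fun t : ℝ => t)
    (hyc : (fun s => y s - c * s ^ n) =o[atTop] fun s : ℝ => s ^ n) :
    (fun t => (∫ s in (0 : ℝ)..t, x s * y s) - q * c / (n + 1) * t ^ (n + 1)) =o[atTop]
      fun t : ℝ => t ^ (n + 1) := by
  -- Split `x y = x (y - c s^n) + c (x - q) s^n + q c s^n`; the first two terms integrate to errors.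
  have h1 := isLittleO_integral_mul hx (e := fun s => y s - c * s ^ n) (by fun_prop) hxabs hyc
  have h2 := (isLittleO_integral_mul_pow (X := fun s => x s - q) (by fun_prop) (by
    refine hxq.congr_left fun t => ?_
    rw [intervalIntegral.integral_sub (hx.intervalIntegrable _ _) (by simp)]
    simp [mul_comm]) n).const_mul_left c
  refine (h1.add h2).congr_left fun t => ?_
  have hi {f : ℝ → ℝ} (hf : Continuous f) : IntervalIntegrable f volume 0 t :=
    hf.intervalIntegrable _ _
  have e1 : ∫ s in (0 : ℝ)..t, x s * (y s - c * s ^ n)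
      = (∫ s in (0 : ℝ)..t, x s * y s) - c * ∫ s in (0 : ℝ)..t, x s * s ^ n := by
    rw [← intervalIntegral.integral_const_mul,
      ← intervalIntegral.integral_sub (hi (by fun_prop)) (hi (by fun_prop))]
    congr 1; ext s; ring
  have e2 : ∫ s in (0 : ℝ)..t, (x s - q) * s ^ n
      = (∫ s in (0 : ℝ)..t, x s * s ^ n) - q * (t ^ (n + 1) / (n + 1)) := by
    have : ∫ s in (0 : ℝ)..t, s ^ n = t ^ (n + 1) / (n + 1) := by simp
    rw [← this, ← intervalIntegral.integral_const_mul,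
      ← intervalIntegral.integral_sub (hi (by fun_prop)) (hi (by fun_prop))]
    congr 1; ext s; ring
  rw [e1, e2]
  ring

lemma tendsto_inv_mul_iff_isLittleO {f : ℝ → ℝ} {c : ℝ} {n : ℕ} :
    Tendsto (fun t : ℝ => (t ^ n)⁻¹ * f t) atTop (𝓝 c) ↔
      (fun t => f t - c * t ^ n) =o[atTop] fun t : ℝ => t ^ n := by
  have h0 : ∀ᶠ t : ℝ in atTop, t ^ n ≠ 0 :=
    (eventually_gt_atTop 0).mono fun t ht => (pow_pos ht n).ne'
  rw [isLittleO_iff_tendsto' (h0.mono fun t ht h => absurd h ht), ← tendsto_sub_nhds_zero_iff]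
  refine tendsto_congr' ?_
  filter_upwards [h0] with t ht
  field_simp

/-- The iterated primitives `∫_0^t x_{i_ν}(s_ν) ∫_0^{s_ν} ⋯ ∫_0^{s_2} x_{i_1}(s_1) ds_1 ⋯ ds_ν`. -/
noncomputable def iteratedPrimitive {ι : Type*} (x : ι → ℝ → ℝ) :
    (ν : ℕ) → (Fin ν → ι) → ℝ → ℝ
  | 0, _, _ => 1
  | ν + 1, i, t => ∫ s in (0 : ℝ)..t,
      x (i (Fin.last ν)) s * iteratedPrimitive x ν (fun j => i j.castSucc) s

lemma continuous_iteratedPrimitive {ι : Type*} {x : ι → ℝ → ℝ} (hx : ∀ k, Continuous (x k))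
    (ν : ℕ) (i : Fin ν → ι) : Continuous (iteratedPrimitive x ν i) := by
  induction ν with
  | zero => exact continuous_const
  | succ ν ih =>
    have : Continuous fun s => x (i (Fin.last ν)) s *
      iteratedPrimitive x ν (fun j => i j.castSucc) s := (hx _).mul (ih _)
    exact intervalIntegral.continuous_primitive (fun a b => this.intervalIntegrable a b) 0

theorem tendsto_iteratedPrimitive {ι : Type*} {x : ι → ℝ → ℝ} {q : ι → ℝ}
    (hx : ∀ k, Continuous (x k))
    (hxq : ∀ k, Tendsto (fun t : ℝ => t⁻¹ * ∫ s in (0 : ℝ)..t, x k s) atTop (𝓝 (q k)))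
    (hxabs : ∀ k, (fun t => ∫ s in (0 : ℝ)..t, |x k s|) =O[atTop] fun t : ℝ => t)
    (ν : ℕ) (i : Fin ν → ι) :
    Tendsto (fun t : ℝ => (t ^ ν)⁻¹ * iteratedPrimitive x ν i t) atTop
      (𝓝 (1 / (ν ! : ℝ) * ∏ j, q (i j))) := by
  induction ν with
  | zero => simp [iteratedPrimitive]
  | succ ν ih =>
    have hq : (fun t => (∫ s in (0 : ℝ)..t, x (i (Fin.last ν)) s) - q (i (Fin.last ν)) * t)
        =o[atTop] fun t : ℝ => t := by
      have := tendsto_inv_mul_iff_isLittleO (n := 1) (c := q (i (Fin.last ν)))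
        (f := fun t => ∫ s in (0 : ℝ)..t, x (i (Fin.last ν)) s)
      simp only [pow_one] at this
      exact this.1 (hxq _)
    rw [tendsto_inv_mul_iff_isLittleO]
    refine (isLittleO_integral_mul_sub (hx (i (Fin.last ν)))
      (continuous_iteratedPrimitive hx ν fun j => i j.castSucc) hq (hxabs _)
      (tendsto_inv_mul_iff_isLittleO.1 (ih fun j => i j.castSucc))).congr_left fun t => ?_
    rw [Fin.prod_univ_castSucc, Nat.factorial_succ, iteratedPrimitive]
    push_cast
    field_simp

end Asymptotics

section OrderedSimplex

/-! ### Simplex integrals as iterated primitives. -/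

lemma isCompact_orderedSimplex (ν : ℕ) (t : ℝ) : IsCompact (orderedSimplex ν t) := by
  have hcl : IsClosed (orderedSimplex ν t) := by
    simp only [orderedSimplex, Set.ofPred_and, Set.ofPred_forall]
    refine IsClosed.inter (isClosed_iInter fun j => IsClosed.inter ?_ ?_)
      (isClosed_iInter fun j => isClosed_iInter fun k => isClosed_iInter fun _ => ?_)
    all_goals exact isClosed_le (by fun_prop) (by fun_prop)
  exact (isCompact_Icc (a := fun _ : Fin ν => (0 : ℝ)) (b := fun _ => t)).of_isClosed_subset hcl
    fun s hs => ⟨fun j => (hs.1 j).1, fun j => (hs.1 j).2⟩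

lemma snoc_mem_orderedSimplex {ν : ℕ} {t r : ℝ} {s : Fin ν → ℝ} :
    (Fin.snoc s r : Fin (ν + 1) → ℝ) ∈ orderedSimplex (ν + 1) t ↔
      r ∈ Set.Icc 0 t ∧ s ∈ orderedSimplex ν r := by
  simp only [orderedSimplex, Set.mem_ofPred_eq, Fin.forall_fin_succ', Fin.snoc_castSucc,
    Fin.snoc_last, Set.mem_Icc, Fin.castSucc_le_castSucc_iff]
  constructor
  · rintro ⟨⟨h1, h2⟩, h3, h4⟩
    exact ⟨h2, fun j => ⟨(h1 j).1, (h3 j).2 (Fin.le_last _)⟩, fun j => (h3 j).1⟩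
  · rintro ⟨h1, h2, h3⟩
    refine ⟨⟨fun j => ⟨(h2 j).1, (h2 j).2.trans h1.2⟩, h1⟩, fun j => ⟨h3 j, fun _ => (h2 j).2⟩,
      fun j hj => ?_, fun _ => le_rfl⟩
    exact absurd hj (not_le.2 (Fin.castSucc_lt_last j))

/-- Fubini in the last, hence largest, coordinate `r`: the others range over the simplex of height
`r`. -/
lemma setIntegral_orderedSimplex_succ {ν : ℕ} {y : Fin (ν + 1) → ℝ → ℝ}
    (hy : ∀ j, Continuous (y j)) {t : ℝ} (ht : 0 ≤ t) :
    ∫ s in orderedSimplex (ν + 1) t, ∏ j, y j (s j) =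
      ∫ r in (0 : ℝ)..t, y (Fin.last ν) r *
        ∫ s in orderedSimplex ν r, ∏ j, y j.castSucc (s j) := by
  have hmeas (n : ℕ) (t : ℝ) : MeasurableSet (orderedSimplex n t) :=
    (isCompact_orderedSimplex n t).measurableSet
  set f : (Fin (ν + 1) → ℝ) → ℝ :=
    (orderedSimplex (ν + 1) t).indicator fun s => ∏ j, y j (s j) with hf
  have hfi : Integrable f := by
    rw [hf, integrable_indicator_iff (hmeas _ _)]
    exact ContinuousOn.integrableOn_compact (isCompact_orderedSimplex _ _)
      (by fun_prop)
  have hmp := (volume_preserving_piFinSuccAbove (fun _ : Fin (ν + 1) => ℝ) (Fin.last ν)).symm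
  have hfe (r : ℝ) (s : Fin ν → ℝ) :
      f ((MeasurableEquiv.piFinSuccAbove (fun _ : Fin (ν + 1) => ℝ) (Fin.last ν)).symm (r, s)) =
      (Set.Icc 0 t).indicator (y (Fin.last ν)) r *
        (orderedSimplex ν r).indicator (fun s => ∏ j, y j.castSucc (s j)) s := by
    have : (MeasurableEquiv.piFinSuccAbove (fun _ : Fin (ν + 1) => ℝ) (Fin.last ν)).symm (r, s)
        = (Fin.snoc s r : Fin (ν + 1) → ℝ) := by
      rw [← Fin.insertNth_last']
      rfl
    rw [this, hf]
    by_cases h1 : r ∈ Set.Icc 0 t <;> by_cases h2 : s ∈ orderedSimplex ν r <;>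
      simp [Set.indicator, snoc_mem_orderedSimplex, h1, h2, Fin.prod_univ_castSucc, mul_comm]
  rw [← integral_indicator (hmeas _ _), ← hf, ← hmp.integral_comp', Measure.volume_eq_prod,
    integral_prod]
  · simp_rw [hfe, integral_const_mul, integral_indicator (hmeas _ _)]
    rw [intervalIntegral.integral_of_le ht, ← integral_Icc_eq_integral_Ioc,
      ← integral_indicator measurableSet_Icc]
    congr 1 with r
    by_cases h1 : r ∈ Set.Icc 0 t <;> simp [Set.indicator, h1]
  · exact hmp.integrable_comp_of_integrable hfi

lemma setIntegral_orderedSimplex_eq_iteratedPrimitive {ι : Type*} {x : ι → ℝ → ℝ}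
    (hx : ∀ k, Continuous (x k)) (ν : ℕ) (i : Fin ν → ι) {t : ℝ} (ht : 0 ≤ t) :
    ∫ s in orderedSimplex ν t, ∏ j, x (i j) (s j) = iteratedPrimitive x ν i t := by
  induction ν generalizing t with
  | zero =>
    have : orderedSimplex 0 t = Set.univ := by ext; simp [orderedSimplex]
    simp [this, iteratedPrimitive, Measure.real, volume_pi]
  | succ ν ih =>
    rw [setIntegral_orderedSimplex_succ (y := fun j => x (i j)) (fun j => hx _) ht,
      iteratedPrimitive]
    refine intervalIntegral.integral_congr fun r hr => ?_
    rw [Set.uIcc_of_le ht] at hr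
    rw [ih _ hr.1]

end OrderedSimplex

section PathSpace

/-! ### Stationary processes as shift-invariant laws on path space. -/

variable {E : Type*}

/-- The unit time shift on the space of all paths. -/
def pathShift (w : ℝ≥0 → E) : ℝ≥0 → E := fun t => w (t + 1)

lemma iterate_pathShift (n : ℕ) (w : ℝ≥0 → E) : pathShift^[n] w = fun t => w (t + n) := by
  induction n with
  | zero => simp
  | succ n ih =>
    rw [Function.iterate_succ_apply', ih]
    ext t
    simp only [pathShift]
    push_cast
    ring_nf

/-- The integral over `[0, 1]` of `g` along a path, sampled at the multiples of `1 / k`. -/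
noncomputable def sampledIntegral (g : E → ℝ) (k : ℕ) (w : ℝ≥0 → E) : ℝ :=
  ∫ s in (0 : ℝ)..1, g (w ((⌊s * k⌋₊ : ℝ≥0) / k))

/-- A measurable functional on the space of all paths which agrees with `∫_0^1 g(w(s)) ds` on
continuous paths `w`. -/
noncomputable def unitIntegral (g : E → ℝ) (w : ℝ≥0 → E) : ℝ :=
  limsup (fun k => sampledIntegral g k w) atTop

section Continuous

variable [TopologicalSpace E]

/-- Dominated convergence, since `⌊s k⌋ / k → s`. Sampling keeps the functional measurable for the
product σ-algebra. -/
lemma tendsto_sampledIntegral {g : E → ℝ} (hg : Continuous g) {x : ℝ≥0 → E}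
    (hx : Continuous x) :
    Tendsto (fun k => sampledIntegral g k x) atTop
      (𝓝 (∫ s in (0 : ℝ)..1, g (x s.toNNReal))) := by
  have hgx : Continuous fun t => g (x t) := hg.comp hx
  obtain ⟨C, hC⟩ := (isCompact_Icc (a := (0 : ℝ≥0)) (b := 1)).exists_bound_of_continuousOn
    hgx.continuousOn
  refine intervalIntegral.tendsto_integral_filter_of_dominated_convergence (fun _ => C)
    (Eventually.of_forall fun k => ?_) (Eventually.of_forall fun k => ae_of_all _ fun s hs => ?_)
    (by simp) (ae_of_all _ fun s hs => ?_)
  · have h1 : Measurable fun n : ℕ => g (x ((n : ℝ≥0) / k)) := measurable_from_nat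
    have h2 : Measurable fun s : ℝ => ⌊s * k⌋₊ := by fun_prop
    exact (h1.comp h2).aestronglyMeasurable
  · rw [Set.uIoc_of_le zero_le_one] at hs
    refine hC _ ⟨zero_le, div_le_one_of_le₀ ?_ zero_le⟩
    have : (⌊s * k⌋₊ : ℝ) ≤ k := (Nat.floor_le (by have := hs.1; positivity)).trans
      (mul_le_of_le_one_left (Nat.cast_nonneg k) hs.2)
    exact_mod_cast this
  · rw [Set.uIoc_of_le zero_le_one] at hs
    refine (hgx.tendsto s.toNNReal).comp ?_
    rw [← NNReal.tendsto_coe, Real.coe_toNNReal s hs.1.le]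
    push_cast
    exact (tendsto_nat_floor_mul_div_atTop hs.1.le).comp tendsto_natCast_atTop_atTop

lemma unitIntegral_eq {g : E → ℝ} (hg : Continuous g) {x : ℝ≥0 → E} (hx : Continuous x) :
    unitIntegral g x = ∫ s in (0 : ℝ)..1, g (x s.toNNReal) :=
  (tendsto_sampledIntegral hg hx).limsup_eq

lemma birkhoffSum_unitIntegral {g : E → ℝ} (hg : Continuous g) {x : ℝ≥0 → E}
    (hx : Continuous x) (n : ℕ) :
    birkhoffSum pathShift (unitIntegral g) n x = ∫ s in (0 : ℝ)..n, g (x s.toNNReal) := by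
  have hc : Continuous fun s : ℝ => g (x s.toNNReal) := by fun_prop
  have h1 (k : ℕ) : unitIntegral g (pathShift^[k] x)
      = ∫ s in (k : ℝ)..(k + 1 : ℕ), g (x s.toNNReal) := by
    rw [iterate_pathShift, unitIntegral_eq hg (by fun_prop)]
    have h2 := intervalIntegral.integral_comp_add_right (a := 0) (b := 1)
      (fun s : ℝ => g (x s.toNNReal)) (k : ℝ)
    rw [zero_add, add_comm (1 : ℝ)] at h2
    push_cast
    rw [← h2]
    refine intervalIntegral.integral_congr fun s hs => ?_
    rw [Set.uIcc_of_le zero_le_one] at hs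
    rw [Real.toNNReal_add hs.1 (Nat.cast_nonneg k), Real.toNNReal_natCast]
  have h3 := intervalIntegral.sum_integral_adjacent_intervals (n := n) (a := fun k : ℕ => (k : ℝ))
    (μ := volume) (f := fun s : ℝ => g (x s.toNNReal)) fun k _ => hc.intervalIntegrable _ _
  simp only [Nat.cast_zero] at h3
  rw [birkhoffSum, ← h3]
  exact Finset.sum_congr rfl fun k _ => h1 k

end Continuous

variable {Ω : Type*} [MeasurableSpace Ω] {P : Measure Ω} [MeasurableSpace E] {ξ : ℝ≥0 → Ω → E}

lemma IsStationaryProcess.map_eq (hstat : IsStationaryProcess ξ P) (hmeas : ∀ t, Measurable (ξ t))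
    (h : ℝ≥0) : P.map (ξ h) = P.map (ξ 0) := by
  have := congrArg (Measure.map fun v : Fin 1 → E => v 0) (hstat h 1 fun _ => 0)
  rw [Measure.map_map (measurable_pi_apply 0) (measurable_pi_lambda _ fun _ => hmeas _),
    Measure.map_map (measurable_pi_apply 0) (measurable_pi_lambda _ fun _ => hmeas _)] at this
  simpa [Function.comp_def] using this

/-- Finite-dimensional marginals determine a finite law on path space; each finite set of times is
enumerated by some `Fin n`. -/
lemma IsStationaryProcess.measurePreserving_pathShift [IsFiniteMeasure P]
    (hstat : IsStationaryProcess ξ P) (hmeas : ∀ t, Measurable (ξ t)) :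
    MeasurePreserving pathShift (P.map fun ω t => ξ t ω) (P.map fun ω t => ξ t ω) := by
  have hT : Measurable (pathShift : (ℝ≥0 → E) → ℝ≥0 → E) :=
    measurable_pi_lambda _ fun t => measurable_pi_apply (t + 1)
  refine ⟨hT, ?_⟩
  rw [Measure.map_map hT (measurable_pi_lambda _ hmeas)]
  refine (ProbabilityTheory.map_eq_iff_forall_finset_map_restrict_eq
    (X := fun t ω => ξ (t + 1) ω) (Y := ξ)
    (measurable_pi_lambda _ fun t => hmeas _).aemeasurable
    (measurable_pi_lambda _ hmeas).aemeasurable).2 fun I => ?_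
  let e := I.equivFin
  have hr : Measurable fun (v : Fin I.card → E) (k : I) => v (e k) :=
    measurable_pi_lambda _ fun k => measurable_pi_apply _
  have := congrArg (Measure.map fun (v : Fin I.card → E) (k : I) => v (e k))
    (hstat 1 I.card fun j => (e.symm j : ℝ≥0))
  rw [Measure.map_map hr (measurable_pi_lambda _ fun _ => hmeas _),
    Measure.map_map hr (measurable_pi_lambda _ fun _ => hmeas _)] at this
  simpa [Function.comp_def, Finset.restrict_def] using this

lemma measurable_sampled {g : E → ℝ} (hg : Measurable g) (k : ℕ) :
    Measurable fun p : (ℝ≥0 → E) × ℝ => g (p.1 ((⌊p.2 * k⌋₊ : ℝ≥0) / k)) := by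
  have h1 : Measurable fun p : (ℝ≥0 → E) × ℕ => g (p.1 ((p.2 : ℝ≥0) / k)) :=
    measurable_from_prod_countable_left fun n =>
      hg.comp (measurable_pi_apply ((n : ℝ≥0) / k))
  have h2 : Measurable fun p : (ℝ≥0 → E) × ℝ => (p.1, ⌊p.2 * k⌋₊) := by fun_prop
  exact h1.comp h2

lemma measurable_sampledIntegral {g : E → ℝ} (hg : Measurable g) (k : ℕ) :
    Measurable (sampledIntegral g k) := by
  unfold sampledIntegral
  simp_rw [intervalIntegral.integral_of_le zero_le_one]
  exact (measurable_sampled hg k).stronglyMeasurable.integral_prod_right.measurable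

lemma measurable_unitIntegral {g : E → ℝ} (hg : Measurable g) : Measurable (unitIntegral g) :=
  Measurable.limsup fun k => measurable_sampledIntegral hg k

/-- Tonelli, as every sampled value has the law of `ξ 0`. The bound is uniform in `k`, so Fatou then
gives integrability of `unitIntegral`. -/
lemma lintegral_enorm_sampledIntegral_le [SFinite P] (hmeas : ∀ t, Measurable (ξ t))
    (hstat : IsStationaryProcess ξ P) {g : E → ℝ} (hg : Measurable g) (k : ℕ) :
    ∫⁻ ω, ‖sampledIntegral g k fun t => ξ t ω‖ₑ ∂P ≤ ∫⁻ ω, ‖g (ξ 0 ω)‖ₑ ∂P := by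
  have hpath : Measurable fun ω t => ξ t ω := measurable_pi_lambda _ hmeas
  have hid (t : ℝ≥0) : ∫⁻ ω, ‖g (ξ t ω)‖ₑ ∂P = ∫⁻ ω, ‖g (ξ 0 ω)‖ₑ ∂P := by
    rw [← lintegral_map (f := fun x => ‖g x‖ₑ) hg.enorm (hmeas t), hstat.map_eq hmeas,
      lintegral_map hg.enorm (hmeas 0)]
  calc ∫⁻ ω, ‖sampledIntegral g k fun t => ξ t ω‖ₑ ∂P
      ≤ ∫⁻ ω, (∫⁻ s in Set.Ioc (0 : ℝ) 1, ‖g (ξ ((⌊s * k⌋₊ : ℝ≥0) / k) ω)‖ₑ) ∂P := by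
        refine lintegral_mono fun ω => ?_
        rw [sampledIntegral, intervalIntegral.integral_of_le zero_le_one]
        exact enorm_integral_le_lintegral_enorm _
    _ = ∫⁻ s in Set.Ioc (0 : ℝ) 1, ∫⁻ ω, ‖g (ξ ((⌊s * k⌋₊ : ℝ≥0) / k) ω)‖ₑ ∂P := by
        refine lintegral_lintegral_swap (Measurable.aemeasurable ?_)
        exact ((measurable_sampled hg k).comp
          ((hpath.comp measurable_fst).prodMk measurable_snd)).enorm
    _ = ∫⁻ ω, ‖g (ξ 0 ω)‖ₑ ∂P := by simp [hid]

variable [TopologicalSpace E] [OpensMeasurableSpace E]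

lemma integrable_unitIntegral [SFinite P] (hmeas : ∀ t, Measurable (ξ t))
    (hcont : ∀ᵐ ω ∂P, Continuous fun t => ξ t ω) (hstat : IsStationaryProcess ξ P)
    {g : E → ℝ} (hg : Continuous g) (hint : Integrable (fun ω => g (ξ 0 ω)) P) :
    Integrable (unitIntegral g) (P.map fun ω t => ξ t ω) := by
  have hpath : Measurable fun ω t => ξ t ω := measurable_pi_lambda _ hmeas
  have hm := measurable_unitIntegral hg.measurable
  rw [integrable_map_measure hm.aestronglyMeasurable hpath.aemeasurable]
  refine ⟨(hm.comp hpath).aestronglyMeasurable, ?_⟩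
  calc ∫⁻ ω, ‖unitIntegral g fun t => ξ t ω‖ₑ ∂P
      ≤ ∫⁻ ω, liminf (fun k => ‖sampledIntegral g k fun t => ξ t ω‖ₑ) atTop ∂P := by
        refine lintegral_mono_ae ?_
        filter_upwards [hcont] with ω hω
        rw [unitIntegral_eq hg hω]
        exact (tendsto_sampledIntegral hg hω).enorm.liminf_eq.ge
    _ ≤ liminf (fun k => ∫⁻ ω, ‖sampledIntegral g k fun t => ξ t ω‖ₑ ∂P) atTop :=
        lintegral_liminf_le fun k =>
          ((measurable_sampledIntegral hg.measurable k).comp hpath).enorm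
    _ ≤ ∫⁻ ω, ‖g (ξ 0 ω)‖ₑ ∂P :=
        liminf_le_of_frequently_le' (Frequently.of_forall fun k =>
          lintegral_enorm_sampledIntegral_le hmeas hstat hg.measurable k)
    _ < ⊤ := hint.2

/-- The pointwise ergodic theorem along integer times for a continuous stationary process. -/
lemma exists_measurable_tendsto_natCast_average [IsFiniteMeasure P] (hmeas : ∀ t, Measurable (ξ t))
    (hcont : ∀ᵐ ω ∂P, Continuous fun t => ξ t ω) (hstat : IsStationaryProcess ξ P)
    {g : E → ℝ} (hg : Continuous g) (hint : Integrable (fun ω => g (ξ 0 ω)) P) :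
    ∃ l : Ω → ℝ, Measurable l ∧ ∀ᵐ ω ∂P,
      Tendsto (fun n : ℕ => (n : ℝ)⁻¹ * ∫ s in (0 : ℝ)..n, g (ξ s.toNNReal ω)) atTop
        (𝓝 (l ω)) := by
  have hpath : Measurable fun ω t => ξ t ω := measurable_pi_lambda _ hmeas
  obtain ⟨l, hl, hlim⟩ := exists_measurable_tendsto_birkhoffAverage
    (hstat.measurePreserving_pathShift hmeas) (measurable_unitIntegral hg.measurable)
    (integrable_unitIntegral hmeas hcont hstat hg hint)
  refine ⟨fun ω => l fun t => ξ t ω, hl.comp hpath, ?_⟩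
  filter_upwards [ae_of_ae_map hpath.aemeasurable hlim, hcont] with ω hω hωc
  refine hω.congr fun n => ?_
  rw [birkhoffAverage, birkhoffSum_unitIntegral hg hωc, smul_eq_mul]

end PathSpace

section ContinuousTime

/-! ### From integer to real times. -/

lemma tendsto_average_floor {G : ℝ → ℝ} {r : ℝ}
    (h : Tendsto (fun n : ℕ => (n : ℝ)⁻¹ * G n) atTop (𝓝 r)) (m : ℕ) :
    Tendsto (fun t : ℝ => t⁻¹ * G (⌊t⌋₊ + m : ℕ)) atTop (𝓝 r) := by
  have h1 := (h.comp (tendsto_add_atTop_nat m)).comp (tendsto_nat_floor_atTop (α := ℝ))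
  have h2 : Tendsto (fun t : ℝ => ((⌊t⌋₊ + m : ℕ) : ℝ) * t⁻¹) atTop (𝓝 1) := by
    have h3 := (tendsto_nat_floor_div_atTop (R := ℝ)).add
      (tendsto_inv_atTop_zero.const_mul (m : ℝ))
    rw [mul_zero, add_zero] at h3
    refine h3.congr fun t => ?_
    push_cast
    ring
  have h4 := h2.mul h1
  rw [one_mul] at h4
  refine h4.congr' ?_
  filter_upwards [eventually_ge_atTop (1 : ℝ)] with t ht
  have : ((⌊t⌋₊ + m : ℕ) : ℝ) ≠ 0 := by
    have := Nat.floor_pos.2 ht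
    positivity
  simp only [Function.comp_apply]
  field_simp

/-- The leftover integral over `[⌊t⌋, t]` is at most `∫ |u|` over `[⌊t⌋, ⌊t⌋ + 1]`, a difference of
two quantities that, divided by `t`, both tend to `r`. -/
lemma tendsto_average_of_natCast {u : ℝ → ℝ} (hu : Continuous u) {q r : ℝ}
    (hq : Tendsto (fun n : ℕ => (n : ℝ)⁻¹ * ∫ s in (0 : ℝ)..n, u s) atTop (𝓝 q))
    (hr : Tendsto (fun n : ℕ => (n : ℝ)⁻¹ * ∫ s in (0 : ℝ)..n, |u s|) atTop (𝓝 r)) :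
    Tendsto (fun t : ℝ => t⁻¹ * ∫ s in (0 : ℝ)..t, u s) atTop (𝓝 q) := by
  have h0 := tendsto_average_floor (G := fun t => ∫ s in (0 : ℝ)..t, u s) hq 0
  have ha := tendsto_average_floor (G := fun t => ∫ s in (0 : ℝ)..t, |u s|) hr
  have hd := (ha 1).sub (ha 0)
  rw [sub_self] at hd
  have hi (a b : ℝ) := hu.intervalIntegrable (μ := volume) a b
  have hi' (a b : ℝ) := hu.abs.intervalIntegrable (μ := volume) a b
  have hrest : Tendsto (fun t : ℝ => t⁻¹ * ∫ s in (⌊t⌋₊ : ℝ)..t, u s) atTop (𝓝 0) := by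
    refine squeeze_zero_norm' ?_ hd
    filter_upwards [eventually_gt_atTop 0] with t ht
    have hf : (⌊t⌋₊ : ℝ) ≤ t := Nat.floor_le ht.le
    have hf' : t ≤ (⌊t⌋₊ + 1 : ℕ) := by push_cast; exact (Nat.lt_floor_add_one t).le
    rw [add_zero, ← mul_sub, intervalIntegral.integral_interval_sub_left (hi' _ _) (hi' _ _),
      norm_mul, Real.norm_eq_abs, abs_of_pos (inv_pos.2 ht)]
    gcongr
    refine (intervalIntegral.norm_integral_le_integral_norm hf).trans ?_
    exact intervalIntegral.integral_mono_interval le_rfl hf hf'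
      (ae_of_all _ fun s => abs_nonneg _) (hi' _ _)
  have := h0.add hrest
  rw [add_zero] at this
  refine this.congr fun t => ?_
  rw [add_zero, ← mul_add, intervalIntegral.integral_add_adjacent_intervals (hi _ _) (hi _ _)]

end ContinuousTime

section Coordinates

/-! ### Reduction to coordinates. -/

variable {Ω : Type*} [MeasurableSpace Ω] {P : Measure Ω} {d : ℕ}
  {ξ : ℝ≥0 → Ω → EuclideanSpace ℝ (Fin d)}

lemma exists_measurable_tendsto_average_apply [IsFiniteMeasure P]
    (hmeas : ∀ t, Measurable (ξ t)) (hcont : ∀ᵐ ω ∂P, Continuous fun t => ξ t ω)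
    (hstat : IsStationaryProcess ξ P) (hint : Integrable (ξ 0) P) (i : Fin d) :
    ∃ q r : Ω → ℝ, Measurable q ∧ ∀ᵐ ω ∂P,
      Tendsto (fun t : ℝ => t⁻¹ * ∫ s in (0 : ℝ)..t, ξ s.toNNReal ω i) atTop (𝓝 (q ω)) ∧
      Tendsto (fun t : ℝ => t⁻¹ * ∫ s in (0 : ℝ)..t, |ξ s.toNNReal ω i|) atTop (𝓝 (r ω)) := by
  have hi : Integrable (fun ω => ξ 0 ω i) P :=
    (EuclideanSpace.proj (𝕜 := ℝ) i).integrable_comp hint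
  obtain ⟨q, hq, hqlim⟩ := exists_measurable_tendsto_natCast_average hmeas hcont hstat
    (g := fun v => v i) (by fun_prop) hi
  obtain ⟨r, -, hrlim⟩ := exists_measurable_tendsto_natCast_average hmeas hcont hstat
    (g := fun v => |v i|) (by fun_prop) hi.abs
  refine ⟨q, r, hq, ?_⟩
  filter_upwards [hqlim, hrlim, hcont] with ω hω1 hω2 hωc
  have hc : Continuous fun s : ℝ => ξ s.toNNReal ω i := by
    have : Continuous fun s : ℝ => ξ s.toNNReal ω := hωc.comp continuous_real_toNNReal
    fun_prop
  exact ⟨tendsto_average_of_natCast hc hω1 hω2,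
    tendsto_average_of_natCast hc.abs hω2 (by simpa only [abs_abs] using hω2)⟩

lemma timeAverage_apply {x : ℝ≥0 → EuclideanSpace ℝ (Fin d)} (hx : Continuous x) (t : ℝ)
    (i : Fin d) : timeAverage x t i = t⁻¹ * ∫ s in (0 : ℝ)..t, x s.toNNReal i := by
  have hc : Continuous fun s : ℝ => x s.toNNReal := hx.comp continuous_real_toNNReal
  have := (EuclideanSpace.proj (𝕜 := ℝ) i).intervalIntegral_comp_comm
    (hc.intervalIntegrable (μ := volume) 0 t)
  rw [timeAverage, PiLp.smul_apply, smul_eq_mul]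
  exact congrArg (t⁻¹ * ·) this.symm

lemma tendsto_timeAverage_iff {x : ℝ≥0 → EuclideanSpace ℝ (Fin d)} (hx : Continuous x)
    {q : EuclideanSpace ℝ (Fin d)} :
    Tendsto (timeAverage x) atTop (𝓝 q) ↔ ∀ i,
      Tendsto (fun t : ℝ => t⁻¹ * ∫ s in (0 : ℝ)..t, x s.toNNReal i) atTop (𝓝 (q i)) := by
  rw [(PiLp.homeomorph 2 fun _ : Fin d => ℝ).isInducing.tendsto_nhds_iff, tendsto_pi_nhds]
  refine forall_congr' fun i => tendsto_congr fun t => timeAverage_apply hx t i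

end Coordinates

/-! ### Assembly of the two halves. -/

theorem corollary2p5 {Ω : Type*} [MeasurableSpace Ω] (P : Measure Ω) [IsProbabilityMeasure P]
    {d : ℕ} (ξ : ℝ≥0 → Ω → EuclideanSpace ℝ (Fin d))
    (hmeas : ∀ t, Measurable (ξ t))
    (hcont : ∀ᵐ ω ∂P, Continuous fun t => ξ t ω)
    (hstat : IsStationaryProcess ξ P)
    (hint : Integrable (ξ 0) P) :
    (∃ Q : Ω → EuclideanSpace ℝ (Fin d), Measurable Q ∧
      ∀ᵐ ω ∂P, Tendsto (timeAverage fun t => ξ t ω) atTop (𝓝 (Q ω))) ∧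
    ∀ Q : Ω → EuclideanSpace ℝ (Fin d),
      (∀ᵐ ω ∂P, Tendsto (timeAverage fun t => ξ t ω) atTop (𝓝 (Q ω))) →
      ∀ᵐ ω ∂P, ∀ (ν : ℕ) (i : Fin ν → Fin d),
        Tendsto (fun t : ℝ => (t ^ ν)⁻¹ * iteratedPathIntegral (fun s => ξ s ω) i t) atTop
          (𝓝 (1 / (ν ! : ℝ) * ∏ j, Q ω (i j))) := by
  choose q r hqm hlim using exists_measurable_tendsto_average_apply hmeas hcont hstat hint
  rw [← ae_all_iff] at hlim
  constructor
  · refine ⟨fun ω => WithLp.toLp 2 fun i => q i ω, by fun_prop, ?_⟩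
    filter_upwards [hlim, hcont] with ω hω hωc
    exact (tendsto_timeAverage_iff hωc).2 fun i => (hω i).1
  · intro Q hQ
    -- From here on a single path is fixed, so one null set serves all `ν` and `i`.
    filter_upwards [hlim, hcont, hQ] with ω hω hωc hωQ ν i
    have hc (k : Fin d) : Continuous fun s : ℝ => ξ s.toNNReal ω k := by
      have : Continuous fun s : ℝ => ξ s.toNNReal ω := hωc.comp continuous_real_toNNReal
      fun_prop
    -- Only boundedness of the absolute means matters here, not their limit `r`.
    have habs (k : Fin d) : (fun t => ∫ s in (0 : ℝ)..t, |ξ s.toNNReal ω k|) =O[atTop]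
        fun t : ℝ => t := by
      have h1 := ((hω k).2.isBigO_one ℝ).mul (Asymptotics.isBigO_refl (fun t : ℝ => t) atTop)
      simp only [one_mul] at h1
      refine h1.congr' ?_ EventuallyEq.rfl
      filter_upwards [eventually_ne_atTop 0] with t ht
      field_simp
    refine (tendsto_iteratedPrimitive hc ((tendsto_timeAverage_iff hωc).1 hωQ) habs ν i).congr' ?_
    filter_upwards [eventually_ge_atTop 0] with t ht
    rw [← setIntegral_orderedSimplex_eq_iteratedPrimitive hc ν i ht, iteratedPathIntegral]
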